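/- Let $k$ be any field (of arbitrary characteristic, not necessarily algebraically closed) and let $\mathfrak{g}$ be any Lie algebra over $k$ (possibly infinite-dimensional). Let $\mathrm{Rep}(\mathfrak{g})$ be the category of finite-dimensional representations of $\mathfrak{g}$ over $k$, and let $Gr(\mathfrak{g})$ be its Grothendieck ring: the commutative ring whose additive group is generated by the isomorphism classes $[V]$ of finite-dimensional representations of $\mathfrak{g}$, subject to the relations $[V]=[U]+[W]$ for every short exact sequence $0\to U\to V\to W\to 0$ of representations, with product $[V]\cdot[W]=[V\otimes_k W]$, where $x\in\mathfrak{g}$ acts on $V\otimes_k W$ by $x(v\otimes w)=xv\otimes w+v\otimes xw$, and with unit the class of the trivial representation $k$. Then $\mathrm{Spec}(Gr(\mathfrak{g}))$ is connected (in particular non-empty). -/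

import Mathlib

open scoped TensorProduct

universe u v

/-- A finite-dimensional representation of the Lie algebra `g` over the field `k`, that is, an
object of `Rep(g)`. The underlying vector spaces live in the universe of `k`; every
finite-dimensional representation is isomorphic to one on `kⁿ`, so nothing is lost. -/
structure LieFDRep (k : Type u) (g : Type v) [Field k] [LieRing g] [LieAlgebra k g] where
  carrier : Type u
  [addCommGroup : AddCommGroup carrier]
  [module : Module k carrier]
  [lieRingModule : LieRingModule g carrier]
  [lieModule : LieModule k g carrier]
  [finite : Module.Finite k carrier]

namespace LieFDRep

attribute [instance] addCommGroup module lieRingModule lieModule finite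

section

variable {k : Type u} {g : Type v} [Field k] [LieRing g] [LieAlgebra k g]

/-- The tensor product, with action `x (v ⊗ w) = x v ⊗ w + v ⊗ x w`. -/
def tensor (V W : LieFDRep k g) : LieFDRep k g where
  carrier := V.carrier ⊗[k] W.carrier

variable (k g) in
/-- The unit object: the field `k` with the zero action. -/
def triv : LieFDRep k g where
  carrier := TrivialLieModule k g k
  finite := inferInstanceAs (Module.Finite k k)

/-- `V` and `W` are isomorphic as representations. -/
def Iso (V W : LieFDRep k g) : Prop :=
  Nonempty (V.carrier ≃ₗ⁅k, g⁆ W.carrier)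

/-- There is a short exact sequence `0 → U → V → W → 0` of representations. -/
def ShortExact (U V W : LieFDRep k g) : Prop :=
  ∃ (i : U.carrier →ₗ⁅k, g⁆ V.carrier) (p : V.carrier →ₗ⁅k, g⁆ W.carrier),
    Function.Injective i ∧ Function.Exact i p ∧ Function.Surjective p

/-- Build an isomorphism from an equivariant linear equivalence. -/
theorem Iso.of_linearEquiv {V W : LieFDRep k g} (e : V.carrier ≃ₗ[k] W.carrier)
    (h : ∀ (x : g) (v : V.carrier), e ⁅x, v⁆ = ⁅x, e v⁆) : Iso V W :=
  ⟨{ e with map_lie' := fun {x v} => h x v }⟩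

variable (k g) in
/-- Isomorphism as a setoid. -/
def isoSetoid : Setoid (LieFDRep k g) where
  r := Iso
  iseqv :=
    { refl := fun _ => ⟨LieModuleEquiv.refl⟩
      symm := fun ⟨e⟩ => ⟨e.symm⟩
      trans := fun ⟨e⟩ ⟨f⟩ => ⟨e.trans f⟩ }

theorem tensor_congr {V V' W W' : LieFDRep k g} (hV : Iso V V') (hW : Iso W W') :
    Iso (tensor V W) (tensor V' W') := by
  obtain ⟨e⟩ := hV
  obtain ⟨f⟩ := hW
  refine Iso.of_linearEquiv (V := tensor V W) (W := tensor V' W')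
    (TensorProduct.congr e.toLinearEquiv f.toLinearEquiv) ?_
  intro x t
  exact LieModuleHom.map_lie
    (TensorProduct.LieModule.map e.toLieModuleHom f.toLieModuleHom) x t

theorem tensor_assoc (U V W : LieFDRep k g) :
    Iso (tensor (tensor U V) W) (tensor U (tensor V W)) := by
  refine Iso.of_linearEquiv (V := tensor (tensor U V) W) (W := tensor U (tensor V W))
    (TensorProduct.assoc k U.carrier V.carrier W.carrier) ?_
  intro x t
  change (U.carrier ⊗[k] V.carrier) ⊗[k] W.carrier at t
  change TensorProduct.assoc k U.carrier V.carrier W.carrier ⁅x, t⁆ =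
    ⁅x, TensorProduct.assoc k U.carrier V.carrier W.carrier t⁆
  induction t using TensorProduct.induction_on with
  | zero => simp
  | add a b ha hb => simp only [lie_add, map_add, ha, hb]
  | tmul s w =>
    induction s using TensorProduct.induction_on with
    | zero => simp
    | add a b ha hb => simp only [TensorProduct.add_tmul, lie_add, map_add, ha, hb]
    | tmul a b =>
      simp only [TensorProduct.LieModule.lie_tmul_right, TensorProduct.add_tmul,
        TensorProduct.tmul_add, map_add, TensorProduct.assoc_tmul]
      abel

theorem tensor_comm (V W : LieFDRep k g) : Iso (tensor V W) (tensor W V) := by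
  refine Iso.of_linearEquiv (V := tensor V W) (W := tensor W V)
    (TensorProduct.comm k V.carrier W.carrier) ?_
  intro x t
  change V.carrier ⊗[k] W.carrier at t
  change TensorProduct.comm k V.carrier W.carrier ⁅x, t⁆ =
    ⁅x, TensorProduct.comm k V.carrier W.carrier t⁆
  induction t using TensorProduct.induction_on with
  | zero => simp
  | add a b ha hb => simp only [lie_add, map_add, ha, hb]
  | tmul a b =>
    simp only [TensorProduct.LieModule.lie_tmul_right, map_add, TensorProduct.comm_tmul]
    abel

theorem triv_tensor (V : LieFDRep k g) : Iso (tensor (triv k g) V) V := by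
  refine Iso.of_linearEquiv (V := tensor (triv k g) V) (W := V)
    ((TensorProduct.congr (TrivialLieModule.equiv k g k) (LinearEquiv.refl k V.carrier)).trans
      (TensorProduct.lid k V.carrier)) ?_
  intro x t
  change TrivialLieModule k g k ⊗[k] V.carrier at t
  change TensorProduct.lid k V.carrier (TensorProduct.congr (TrivialLieModule.equiv k g k)
      (LinearEquiv.refl k V.carrier) ⁅x, t⁆) =
    ⁅x, TensorProduct.lid k V.carrier (TensorProduct.congr (TrivialLieModule.equiv k g k)
      (LinearEquiv.refl k V.carrier) t)⁆
  induction t using TensorProduct.induction_on with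
  | zero => simp
  | add a b ha hb => simp only [lie_add, map_add, ha, hb]
  | tmul a b =>
    have ha : ⁅x, a⁆ = 0 := trivial_lie_zero g (TrivialLieModule k g k) x a
    simp [TensorProduct.LieModule.lie_tmul_right, ha]

/-- Tensoring with a fixed representation is exact. -/
theorem ShortExact.tensor_left {U V W : LieFDRep k g} (h : ShortExact U V W)
    (X : LieFDRep k g) : ShortExact (tensor X U) (tensor X V) (tensor X W) := by
  obtain ⟨i, p, hi, hip, hp⟩ := h
  refine ⟨TensorProduct.LieModule.map LieModuleHom.id i,
    TensorProduct.LieModule.map LieModuleHom.id p, ?_, ?_, ?_⟩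
  · exact Module.Flat.lTensor_preserves_injective_linearMap (M := X.carrier)
      (i : U.carrier →ₗ[k] V.carrier) hi
  · exact _root_.lTensor_exact X.carrier (f := (i : U.carrier →ₗ[k] V.carrier))
      (g := (p : V.carrier →ₗ[k] W.carrier)) hip hp
  · exact LinearMap.lTensor_surjective X.carrier
      (g := (p : V.carrier →ₗ[k] W.carrier)) hp

end

/-- Isomorphism classes of finite-dimensional representations. -/
def IsoClass (k : Type u) (g : Type v) [Field k] [LieRing g] [LieAlgebra k g] :
    Type (max (u + 1) v) :=
  Quotient (isoSetoid k g)

section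

variable {k : Type u} {g : Type v} [Field k] [LieRing g] [LieAlgebra k g]

/-- The isomorphism class of a representation. -/
def isoClass (V : LieFDRep k g) : IsoClass k g :=
  Quotient.mk (isoSetoid k g) V

/-- Isomorphism classes form a commutative monoid under the tensor product. -/
instance : CommMonoid (IsoClass k g) where
  mul := Quotient.map₂ tensor fun _ _ hV _ _ hW => tensor_congr hV hW
  one := isoClass (triv k g)
  mul_assoc := by
    rintro ⟨U⟩ ⟨V⟩ ⟨W⟩
    exact Quotient.sound (tensor_assoc U V W)
  mul_comm := by
    rintro ⟨V⟩ ⟨W⟩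
    exact Quotient.sound (tensor_comm V W)
  one_mul := by
    rintro ⟨V⟩
    exact Quotient.sound (triv_tensor V)
  mul_one := by
    rintro ⟨V⟩
    exact (Quotient.sound (tensor_comm V (triv k g))).trans (Quotient.sound (triv_tensor V))

theorem isoClass_mul (V W : LieFDRep k g) :
    isoClass V * isoClass W = isoClass (tensor V W) := rfl

theorem one_eq_isoClass : (1 : IsoClass k g) = isoClass (triv k g) := rfl

end

section

variable (k : Type u) (g : Type v) [Field k] [LieRing g] [LieAlgebra k g]

/-- The elements `[V] - [U] - [W]`, one for each short exact sequence `0 → U → V → W → 0`. -/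
def relators : Set (FreeAbelianGroup (IsoClass k g)) :=
  {r | ∃ U V W : LieFDRep k g, ShortExact U V W ∧
    r = FreeAbelianGroup.of (isoClass V) - FreeAbelianGroup.of (isoClass U) -
      FreeAbelianGroup.of (isoClass W)}

/-- The additive subgroup generated by the relators; it is an ideal of the free abelian group on
isomorphism classes (a ring under the tensor product), since the tensor product is exact. -/
def relIdeal : Ideal (FreeAbelianGroup (IsoClass k g)) where
  __ := (AddSubgroup.closure (relators k g)).toAddSubmonoid
  smul_mem' := by
    intro a r hr
    change a * r ∈ AddSubgroup.closure (relators k g)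
    change r ∈ AddSubgroup.closure (relators k g) at hr
    induction a using FreeAbelianGroup.induction_on with
    | zero => simp
    | of X =>
      induction hr using AddSubgroup.closure_induction with
      | zero => simp
      | add a b _ _ ha hb => rw [mul_add]; exact add_mem ha hb
      | neg a _ ha => rw [mul_neg]; exact neg_mem ha
      | mem r hr =>
        obtain ⟨U, V, W, h, rfl⟩ := hr
        obtain ⟨X, rfl⟩ : ∃ Y : LieFDRep k g, isoClass Y = X := Quotient.exists_rep X
        refine AddSubgroup.subset_closure ⟨_, _, _, h.tensor_left X, ?_⟩
        rw [mul_sub, mul_sub, FreeAbelianGroup.of_mul_of, FreeAbelianGroup.of_mul_of,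
          FreeAbelianGroup.of_mul_of, isoClass_mul, isoClass_mul, isoClass_mul]
    | neg X hX => rw [neg_mul]; exact neg_mem hX
    | add a b ha hb => rw [add_mul]; exact add_mem ha hb

/-- The Grothendieck ring `Gr(g)` of the category of finite-dimensional representations of `g`:
generated as an abelian group by the classes of representations, with a relation
`[V] = [U] + [W]` for each short exact sequence `0 → U → V → W → 0`, and with product induced by
the tensor product. -/
abbrev Gr : Type (max (u + 1) v) :=
  FreeAbelianGroup (IsoClass k g) ⧸ relIdeal k g

end

end LieFDRep

/-! The spectrum is connected once 0 and 1 are the only idempotents and 1 ≠ 0. For an idempotent e,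
the dimension map `Gr.trace 1` is multiplicative with values in the field k, so it sends e to 0 or
1; passing to 1 - e if necessary, the value is 0.

Elements of g act on tensor products by the Leibniz rule, so the trace of a word on a product is a
sum, over the splittings of the word, of products of traces. Since e = e², induction on length shows
that every word has trace 0 on e (`Gr.trace_eq_zero_of_isIdempotentElem`). Over an algebraically
closed field of characteristic p, density separates the traces of distinct simple modules, so the
coefficients of e on simple classes are divisible by p, and e = p y (`Gr.exists_eq_ringChar_mul`).
Then e = eⁿ = pⁿ yⁿ for all n ≥ 1, hence every additive map to ℤ kills e.

Over a general k the trace of a simple module may vanish identically (inseparability), so that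
argument is run over the algebraic closure. The return to k uses the integer-valued functionals
`Gr.eigenMult a`, which extension of scalars does not change. By density over k, some a acts as the
identity on one simple constituent and as 0 on the others; its functional reads off the coefficient
times the dimension, so every coefficient of e is 0. -/

/-! ### Trace and characteristic polynomial on an extension -/

section SplitMatrix

variable {k : Type*} [Field k] {U V W : Type*} [AddCommGroup U] [AddCommGroup V] [AddCommGroup W]
  [Module k U] [Module k V] [Module k W] [Module.Finite k U] [Module.Finite k W]

/-- An endomorphism of an extension is block upper triangular in a suitable basis. -/
theorem LinearMap.exists_toMatrix_eq_fromBlocks_of_exact (i : U →ₗ[k] V) (p : V →ₗ[k] W)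
    (hi : Function.Injective i) (hip : Function.Exact i p) (hp : Function.Surjective p)
    (fU : Module.End k U) (fV : Module.End k V) (fW : Module.End k W)
    (hUV : ∀ x, fV (i x) = i (fU x)) (hVW : ∀ x, p (fV x) = fW (p x)) :
    ∃ (b : Module.Basis (Fin (Module.finrank k U) ⊕ Fin (Module.finrank k W)) k V)
      (B : Matrix (Fin (Module.finrank k U)) (Fin (Module.finrank k W)) k),
      LinearMap.toMatrix b b fV = Matrix.fromBlocks
        (LinearMap.toMatrix (Module.finBasis k U) (Module.finBasis k U) fU) B 0
        (LinearMap.toMatrix (Module.finBasis k W) (Module.finBasis k W) fW) := by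
  obtain ⟨s, hs⟩ := p.exists_rightInverse_of_surjective (LinearMap.range_eq_top.2 hp)
  have hs' : ∀ w, p (s w) = w := fun w => LinearMap.congr_fun hs w
  have hpi : ∀ x, p (i x) = 0 := hip.apply_apply_eq_zero
  -- The section `s` is only k-linear, not compatible with the endomorphisms; the defect is the
  -- off-diagonal block.
  let e : (U × W) ≃ₗ[k] V := LinearEquiv.ofBijective (i.coprod s) ⟨by
      rw [injective_iff_map_eq_zero]
      rintro ⟨x, w⟩ h
      simp only [LinearMap.coprod_apply] at h
      have hw : w = 0 := by simpa [hpi, hs'] using congrArg p h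
      subst hw
      have hx : x = 0 := hi (by simpa using h)
      rw [hx]; rfl, by
      intro v
      obtain ⟨x, hx⟩ := (hip (v - s (p v))).1 (by simp [hs'])
      exact ⟨(x, p v), by simp [hx]⟩⟩
  have he : ∀ x w, e (x, w) = i x + s w := fun x w => LinearMap.coprod_apply i s (x, w)
  have hsnd : ∀ v, (e.symm v).2 = p v := by
    intro v
    obtain ⟨⟨x, w⟩, rfl⟩ := e.surjective v
    rw [LinearEquiv.symm_apply_apply, he, map_add, hpi, hs', zero_add]
  have hfst : ∀ x, e.symm (i x) = (x, 0) := by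
    intro x
    rw [LinearEquiv.symm_apply_eq, he]; simp
  let bU := Module.finBasis k U
  let bW := Module.finBasis k W
  let b := (bU.prod bW).map e
  refine ⟨b, (LinearMap.toMatrix b b fV).toBlocks₁₂, ?_⟩
  ext r c
  rcases r with r | r <;> rcases c with c | c
  · simp [LinearMap.toMatrix_apply, b, he, hUV, hfst, bU]
  · simp [Matrix.toBlocks₁₂]
  · simp [LinearMap.toMatrix_apply, b, he, hUV, hsnd, hpi]
  · simp [LinearMap.toMatrix_apply, b, he, hsnd, hVW, hs', bW]

theorem LinearMap.trace_eq_add_of_exact (i : U →ₗ[k] V) (p : V →ₗ[k] W)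
    (hi : Function.Injective i) (hip : Function.Exact i p) (hp : Function.Surjective p)
    (fU : Module.End k U) (fV : Module.End k V) (fW : Module.End k W)
    (hUV : ∀ x, fV (i x) = i (fU x)) (hVW : ∀ x, p (fV x) = fW (p x)) :
    LinearMap.trace k V fV = LinearMap.trace k U fU + LinearMap.trace k W fW := by
  obtain ⟨b, B, h⟩ :=
    LinearMap.exists_toMatrix_eq_fromBlocks_of_exact i p hi hip hp fU fV fW hUV hVW
  rw [LinearMap.trace_eq_matrix_trace k b, h,
    LinearMap.trace_eq_matrix_trace k (Module.finBasis k U),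
    LinearMap.trace_eq_matrix_trace k (Module.finBasis k W)]
  simp [Matrix.trace]

theorem LinearMap.charpoly_eq_mul_of_exact [Module.Finite k V] (i : U →ₗ[k] V) (p : V →ₗ[k] W)
    (hi : Function.Injective i) (hip : Function.Exact i p) (hp : Function.Surjective p)
    (fU : Module.End k U) (fV : Module.End k V) (fW : Module.End k W)
    (hUV : ∀ x, fV (i x) = i (fU x)) (hVW : ∀ x, p (fV x) = fW (p x)) :
    fV.charpoly = fU.charpoly * fW.charpoly := by
  obtain ⟨b, B, h⟩ :=
    LinearMap.exists_toMatrix_eq_fromBlocks_of_exact i p hi hip hp fU fV fW hUV hVW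
  rw [← LinearMap.charpoly_toMatrix fV b, h,
    ← LinearMap.charpoly_toMatrix fU (Module.finBasis k U),
    ← LinearMap.charpoly_toMatrix fW (Module.finBasis k W), Matrix.charpoly_fromBlocks_zero₂₁]

end SplitMatrix

/-! ### Additive functions and the Grothendieck group -/

namespace LieFDRep

section GrothendieckRing

variable {k : Type u} {g : Type v} [Field k] [LieRing g] [LieAlgebra k g]

/-- The class of a representation in the Grothendieck ring. -/
def cls (V : LieFDRep k g) : Gr k g :=
  Ideal.Quotient.mk (relIdeal k g) (FreeAbelianGroup.of (isoClass V))

theorem cls_mul (V W : LieFDRep k g) : cls V * cls W = cls (tensor V W) := by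
  rw [cls, cls, ← map_mul, FreeAbelianGroup.of_mul_of, isoClass_mul, cls]

theorem one_eq_cls : (1 : Gr k g) = cls (triv k g) := rfl

theorem cls_congr {V W : LieFDRep k g} (h : Iso V W) : cls V = cls W := by
  have : isoClass V = isoClass W := Quotient.sound h
  rw [cls, this, cls]

theorem ShortExact.cls_eq {U V W : LieFDRep k g} (h : ShortExact U V W) :
    cls V = cls U + cls W := by
  have : Ideal.Quotient.mk (relIdeal k g) (FreeAbelianGroup.of (isoClass V) -
      FreeAbelianGroup.of (isoClass U) - FreeAbelianGroup.of (isoClass W)) = 0 :=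
    Ideal.Quotient.eq_zero_iff_mem.2 (AddSubgroup.subset_closure ⟨U, V, W, h, rfl⟩)
  rw [map_sub, map_sub, sub_sub, sub_eq_zero] at this
  exact this

@[elab_as_elim]
theorem Gr.induction {P : Gr k g → Prop} (x : Gr k g) (hcls : ∀ V, P (cls V)) (h0 : P 0)
    (hneg : ∀ a, P a → P (-a)) (hadd : ∀ a b, P a → P b → P (a + b)) : P x := by
  obtain ⟨y, rfl⟩ := Ideal.Quotient.mk_surjective x
  induction y using FreeAbelianGroup.induction_on with
  | zero => simpa using h0
  | of X =>
    obtain ⟨V, rfl⟩ : ∃ Y : LieFDRep k g, isoClass Y = X := Quotient.exists_rep X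
    exact hcls V
  | neg X hX => rw [map_neg]; exact hneg _ hX
  | add a b ha hb => rw [map_add]; exact hadd _ _ ha hb

theorem shortExact_of_subsingleton {U V W : LieFDRep k g} (hU : Subsingleton U.carrier)
    (h : Iso V W) : ShortExact U V W := by
  obtain ⟨e⟩ := h
  refine ⟨0, e, fun _ _ _ => Subsingleton.elim _ _, fun x => ?_, e.surjective⟩
  have h0 : e 0 = 0 := map_zero e.toLieModuleHom
  constructor
  · intro hx
    exact ⟨0, (e.injective (hx.trans h0.symm)).symm⟩
  · rintro ⟨y, rfl⟩
    exact h0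

/-- Additivity already implies invariance: the sequence 0 → 0 → 0 → 0 → 0 gives f(0) = 0, and an
isomorphism is a short exact sequence with zero kernel. -/
theorem eq_of_iso_of_additive {M : Type*} [AddCommGroup M] (f : LieFDRep k g → M)
    (hf : ∀ U V W, ShortExact U V W → f V = f U + f W) {V W : LieFDRep k g} (h : Iso V W) :
    f V = f W := by
  let Z : LieFDRep k g := { carrier := (⊥ : LieSubmodule k g V.carrier) }
  have hz : Subsingleton Z.carrier :=
    inferInstanceAs (Subsingleton (⊥ : LieSubmodule k g V.carrier))
  have h0 : f Z = 0 :=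
    left_eq_add.1 (hf _ _ _ (shortExact_of_subsingleton hz ((isoSetoid k g).refl Z)))
  rw [hf _ _ _ (shortExact_of_subsingleton hz h), h0, zero_add]

theorem cls_eq_zero {V : LieFDRep k g} (hV : Subsingleton V.carrier) : cls V = 0 :=
  left_eq_add.1 (shortExact_of_subsingleton hV ((isoSetoid k g).refl V)).cls_eq

/-- The homomorphism out of the Grothendieck group given by a function that is additive on short
exact sequences. -/
def Gr.lift {M : Type*} [AddCommGroup M] (f : LieFDRep k g → M)
    (hf : ∀ U V W, ShortExact U V W → f V = f U + f W) : Gr k g →+ M :=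
  QuotientAddGroup.lift (relIdeal k g).toAddSubgroup
    (FreeAbelianGroup.lift (Quotient.lift (s := isoSetoid k g) f fun _ _ h => eq_of_iso_of_additive f hf h)) <| by
    intro x hx
    change x ∈ AddSubgroup.closure (relators k g) at hx
    refine AddMonoidHom.mem_ker.1 ((AddSubgroup.closure_le _).2 ?_ hx)
    rintro _ ⟨U, V, W, h, rfl⟩
    refine AddMonoidHom.mem_ker.2 ?_
    rw [map_sub, map_sub]
    erw [FreeAbelianGroup.lift_apply_of, FreeAbelianGroup.lift_apply_of,
      FreeAbelianGroup.lift_apply_of]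
    change f V - f U - f W = 0
    rw [hf U V W h]
    abel

@[simp]
theorem Gr.lift_cls {M : Type*} [AddCommGroup M] (f : LieFDRep k g → M)
    (hf : ∀ U V W, ShortExact U V W → f V = f U + f W) (V : LieFDRep k g) :
    Gr.lift f hf (cls V) = f V := by
  exact FreeAbelianGroup.lift_apply_of _ _

end GrothendieckRing

/-! ### Words in g: traces, eigenvalue multiplicities and products -/

section Action

variable {k : Type u} {g : Type v} [Field k] [LieRing g] [LieAlgebra k g]

/-- The action of words in `g` on a representation. -/
def wordAct (V : LieFDRep k g) : FreeMonoid g →* Module.End k V.carrier :=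
  FreeMonoid.lift fun x => LieModule.toEnd k g V.carrier x

/-- The action on a representation of the free algebra on the set `g`. -/
noncomputable def act (V : LieFDRep k g) :
    MonoidAlgebra k (FreeMonoid g) →ₐ[k] Module.End k V.carrier :=
  MonoidAlgebra.lift k _ _ (wordAct V)

@[simp]
theorem wordAct_of (V : LieFDRep k g) (x : g) (v : V.carrier) :
    wordAct V (FreeMonoid.of x) v = ⁅x, v⁆ := by
  simp [wordAct]

@[simp]
theorem act_of (V : LieFDRep k g) (w : FreeMonoid g) :
    act V (MonoidAlgebra.of k _ w) = wordAct V w :=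
  MonoidAlgebra.lift_of _ _

theorem wordAct_map {V W : LieFDRep k g} (φ : V.carrier →ₗ⁅k, g⁆ W.carrier) (w : FreeMonoid g)
    (v : V.carrier) : φ (wordAct V w v) = wordAct W w (φ v) := by
  induction w using FreeMonoid.inductionOn' with
  | one => simp
  | of_mul x w ih => simp [ih]

theorem act_map {V W : LieFDRep k g} (φ : V.carrier →ₗ⁅k, g⁆ W.carrier)
    (a : MonoidAlgebra k (FreeMonoid g)) (v : V.carrier) : φ (act V a v) = act W a (φ v) := by
  induction a using MonoidAlgebra.induction_on with
  | of w => rw [act_of, act_of, wordAct_map]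
  | add a b ha hb => simp [ha, hb]
  | smul c a ha => simp [ha]

/-- The trace of an element of the free algebra, as a function on the Grothendieck group. -/
noncomputable def Gr.trace (a : MonoidAlgebra k (FreeMonoid g)) : Gr k g →+ k :=
  Gr.lift (fun V => LinearMap.trace k V.carrier (act V a)) <| by
    rintro U V W ⟨i, p, hi, hip, hp⟩
    exact LinearMap.trace_eq_add_of_exact (i : U.carrier →ₗ[k] V.carrier)
      (p : V.carrier →ₗ[k] W.carrier) hi hip hp _ _ _ (fun x => (act_map i a x).symm)
      (fun x => act_map p a x)

/-- The multiplicity of the eigenvalue `1` of an element of the free algebra, as a function on the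
Grothendieck group. -/
noncomputable def Gr.eigenMult (a : MonoidAlgebra k (FreeMonoid g)) : Gr k g →+ ℤ :=
  Gr.lift (fun V => ((act V a).charpoly.rootMultiplicity 1 : ℤ)) <| by
    rintro U V W ⟨i, p, hi, hip, hp⟩
    rw [LinearMap.charpoly_eq_mul_of_exact (i : U.carrier →ₗ[k] V.carrier)
      (p : V.carrier →ₗ[k] W.carrier) hi hip hp (act U a) (act V a) (act W a)
      (fun x => (act_map i a x).symm) (fun x => act_map p a x), Polynomial.rootMultiplicity_mul,
      Nat.cast_add]
    exact mul_ne_zero (LinearMap.charpoly_monic _).ne_zero (LinearMap.charpoly_monic _).ne_zero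

@[simp]
theorem Gr.trace_cls (a : MonoidAlgebra k (FreeMonoid g)) (V : LieFDRep k g) :
    Gr.trace a (cls V) = LinearMap.trace k V.carrier (act V a) := Gr.lift_cls _ _ _

@[simp]
theorem Gr.eigenMult_cls (a : MonoidAlgebra k (FreeMonoid g)) (V : LieFDRep k g) :
    Gr.eigenMult a (cls V) = (act V a).charpoly.rootMultiplicity 1 := Gr.lift_cls _ _ _

theorem Gr.trace_add_left (a b : MonoidAlgebra k (FreeMonoid g)) (x : Gr k g) :
    Gr.trace (a + b) x = Gr.trace a x + Gr.trace b x := by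
  induction x using Gr.induction with
  | hcls V => simp
  | h0 => simp
  | hneg a ha => simp [ha, add_comm]
  | hadd a b ha hb => simp only [map_add, ha, hb]; abel

theorem Gr.trace_smul_left (c : k) (a : MonoidAlgebra k (FreeMonoid g)) (x : Gr k g) :
    Gr.trace (c • a) x = c * Gr.trace a x := by
  induction x using Gr.induction with
  | hcls V => simp
  | h0 => simp
  | hneg a ha => simp [ha]
  | hadd a b ha hb => simp only [map_add, ha, hb]; ring

/-- The ways to split a list into two complementary sublists. -/
def splits {α : Type*} : List α → List (List α × List α)
  | [] => [([], [])]
  | x :: l => (splits l).map (fun s => (x :: s.1, s.2)) ++ (splits l).map (fun s => (s.1, x :: s.2))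

theorem length_of_mem_splits {α : Type*} {l : List α} {s : List α × List α} (h : s ∈ splits l) :
    s.1.length + s.2.length = l.length := by
  induction l generalizing s with
  | nil => simp_all [splits]
  | cons x l ih =>
    simp only [splits, List.mem_append, List.mem_map] at h
    rcases h with ⟨t, ht, rfl⟩ | ⟨t, ht, rfl⟩ <;> have := ih ht <;> simp <;> omega

theorem _root_.List.sum_map_neg {α M : Type*} [AddCommGroup M] (l : List α) (f : α → M) :
    (l.map fun a => -f a).sum = -(l.map f).sum := by
  induction l with
  | nil => simp
  | cons a l ih => simp [ih, add_comm]

/-- The word given by a list, as an element of the free algebra. -/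
noncomputable abbrev word (k : Type*) {g : Type*} [Field k] (l : List g) :
    MonoidAlgebra k (FreeMonoid g) :=
  MonoidAlgebra.of k _ (FreeMonoid.ofList l)

/-- Iterated Leibniz rule: each letter acts on one of the two factors, and the order of letters is
kept on each side. -/
theorem wordAct_tensor (V W : LieFDRep k g) (l : List g) :
    wordAct (tensor V W) (FreeMonoid.ofList l) = ((splits l).map fun s =>
      (TensorProduct.map (wordAct V (FreeMonoid.ofList s.1)) (wordAct W (FreeMonoid.ofList s.2)) :
        Module.End k (V.carrier ⊗[k] W.carrier))).sum := by
  induction l with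
  | nil => simp [splits]; rfl
  | cons x l ih =>
    rw [FreeMonoid.ofList_cons, map_mul, ih]
    simp only [splits, List.map_append, List.map_map, List.sum_append, ← List.sum_map_add]
    refine (List.sum_map_mul_left ..).symm.trans ?_
    refine congrArg List.sum (List.map_congr_left fun s _ => ?_)
    refine TensorProduct.ext' fun a b => ?_
    refine (wordAct_of (tensor V W) x _).trans
      ((TensorProduct.LieModule.lie_tmul_right x _ _).trans ?_)
    change _ = (wordAct V (FreeMonoid.of x * FreeMonoid.ofList s.1) a) ⊗ₜ[k]
      (wordAct W (FreeMonoid.ofList s.2) b) + (wordAct V (FreeMonoid.ofList s.1) a) ⊗ₜ[k]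
      (wordAct W (FreeMonoid.of x * FreeMonoid.ofList s.2) b)
    rw [map_mul, map_mul, Module.End.mul_apply, Module.End.mul_apply, wordAct_of, wordAct_of]

theorem Gr.trace_mul (l : List g) (x y : Gr k g) :
    Gr.trace (word k l) (x * y) = ((splits l).map fun s =>
      Gr.trace (word k s.1) x * Gr.trace (word k s.2) y).sum := by
  induction x using Gr.induction with
  | h0 => simp
  | hneg a ha => simp only [neg_mul, map_neg, ha, List.sum_map_neg]
  | hadd a b ha hb => simp only [add_mul, map_add, ha, hb, List.sum_map_add]
  | hcls V =>
    induction y using Gr.induction with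
    | h0 => simp
    | hneg a ha => simp only [mul_neg, map_neg, ha, List.sum_map_neg]
    | hadd a b ha hb => simp only [mul_add, map_add, ha, hb, List.sum_map_add]
    | hcls W =>
      rw [cls_mul]
      simp only [Gr.trace_cls, act_of]
      rw [wordAct_tensor]
      refine (map_list_sum (LinearMap.trace k (V.carrier ⊗[k] W.carrier)) _).trans ?_
      rw [List.map_map]
      refine congrArg List.sum (List.map_congr_left fun s _ => ?_)
      exact LinearMap.trace_tensorProduct' _ _

theorem Gr.trace_one_mul (x y : Gr k g) :
    Gr.trace 1 (x * y) = Gr.trace 1 x * Gr.trace 1 y :=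
  (Gr.trace_mul [] x y).trans List.sum_singleton

theorem Gr.trace_one_one : Gr.trace (1 : MonoidAlgebra k (FreeMonoid g)) (1 : Gr k g) = 1 := by
  rw [one_eq_cls, Gr.trace_cls, map_one, LinearMap.trace_one]
  have : Module.finrank k (triv k g).carrier = 1 := Module.finrank_self k
  simp [this]

/-- Expand the trace of a word on e · e over its splittings. Each term contains either the trace of
a strictly shorter word or that of the empty word, and both vanish on e. -/
theorem Gr.trace_eq_zero_of_isIdempotentElem {e : Gr k g} (he : IsIdempotentElem e)
    (h1 : Gr.trace 1 e = 0) (a : MonoidAlgebra k (FreeMonoid g)) : Gr.trace a e = 0 := by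
  have key : ∀ (n : ℕ) (l : List g), l.length = n → Gr.trace (word k l) e = 0 := by
    intro n
    induction n using Nat.strong_induction_on with
    | _ n ih =>
      intro l hl
      rw [← he.eq, Gr.trace_mul]
      refine List.sum_eq_zero fun t ht => ?_
      obtain ⟨s, hs, rfl⟩ := List.mem_map.1 ht
      have hlen := length_of_mem_splits hs
      rcases lt_or_ge s.1.length n with h | h
      · rw [ih _ h _ rfl, zero_mul]
      · have : s.2 = [] := List.length_eq_zero_iff.1 (by omega)
        rw [this]
        -- The empty word is the unit of the free algebra, so this is the rank hypothesis.
        have : Gr.trace (word k []) e = 0 := h1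
        rw [this, mul_zero]
  induction a using MonoidAlgebra.induction_on with
  | of w => exact key _ w.toList rfl
  | add a b ha hb => rw [Gr.trace_add_left, ha, hb, add_zero]
  | smul c a ha => rw [Gr.trace_smul_left, ha, mul_zero]

end Action

end LieFDRep

/-! ### Density for finitely many simple modules -/

/-- Density for finitely many simple modules: an endomorphism of one of them that commutes with its
module endomorphisms is induced by a scalar that kills the others. -/
theorem IsSimpleModule.exists_smul_eq {k A ι : Type*} [Field k] [Ring A] [Algebra k A] [Finite ι]
    (M : ι → Type*) [∀ i, AddCommGroup (M i)] [∀ i, Module k (M i)] [∀ i, Module A (M i)]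
    [∀ i, IsScalarTower k A (M i)] [∀ i, Module.Finite k (M i)] [∀ i, IsSimpleModule A (M i)]
    (c : ι) (hc : ∀ d, d ≠ c → IsEmpty (M c ≃ₗ[A] M d)) (T : Module.End k (M c))
    (hT : ∀ (φ : Module.End A (M c)) (v : M c), T (φ v) = φ (T v)) :
    ∃ a : A, (∀ v : M c, a • v = T v) ∧ ∀ d, d ≠ c → ∀ v : M d, a • v = 0 := by
  classical
  -- By Schur's lemma nothing nonzero maps between `M c` and another factor, so every endomorphism
  -- of the product acts on the c-coordinate separately.
  have hout : ∀ d, d ≠ c → ∀ ψ : M c →ₗ[A] M d, ψ = 0 := fun d hd ψ =>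
    (LinearMap.bijective_or_eq_zero ψ).resolve_left fun h =>
      (hc d hd).false (LinearEquiv.ofBijective ψ h)
  have hin : ∀ d, d ≠ c → ∀ ψ : M d →ₗ[A] M c, ψ = 0 := fun d hd ψ =>
    (LinearMap.bijective_or_eq_zero ψ).resolve_left fun h =>
      (hc d hd).false (LinearEquiv.ofBijective ψ h).symm
  let diag : Module.End A (∀ i, M i) → Module.End A (M c) := fun φ =>
    LinearMap.proj c ∘ₗ φ ∘ₗ LinearMap.single A M c
  have hdiag : ∀ φ m, φ m c = diag φ (m c) := by
    intro φ m
    have : LinearMap.proj c ∘ₗ φ = diag φ ∘ₗ LinearMap.proj c := by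
      refine LinearMap.pi_ext fun d x => ?_
      by_cases hd : d = c
      · subst hd
        simp [diag]
      · have h := LinearMap.congr_fun
          (hin d hd (LinearMap.proj c ∘ₗ φ ∘ₗ LinearMap.single A M d)) x
        simp only [LinearMap.comp_apply, LinearMap.proj_apply, LinearMap.single_apply,
          LinearMap.zero_apply] at h
        simp [h, Pi.single_eq_of_ne (Ne.symm hd)]
    exact LinearMap.congr_fun this m
  have hsingle : ∀ φ v, φ (Pi.single c v) = Pi.single c (diag φ v) := by
    intro φ v
    ext d
    by_cases hd : d = c
    · subst hd
      simp [diag]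
    · have h := LinearMap.congr_fun
        (hout d hd (LinearMap.proj d ∘ₗ φ ∘ₗ LinearMap.single A M c)) v
      simp only [LinearMap.comp_apply, LinearMap.proj_apply, LinearMap.single_apply,
        LinearMap.zero_apply] at h
      simp [h, Pi.single_eq_of_ne hd]
  -- T on the factor `M c` and 0 on the others: linear over the commutant, as the density theorem
  -- requires.
  let f : Module.End (Module.End A (∀ i, M i)) (∀ i, M i) :=
    { toFun := fun m => Pi.single c (T (m c))
      map_add' := fun m n => by rw [Pi.add_apply, map_add, Pi.single_add]
      map_smul' := fun φ m => by
        simp only [Module.End.smul_def, RingHom.id_apply, hdiag, hT, hsingle] }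
  have := Fintype.ofFinite ι
  -- Density gives agreement on a finite set only; a k-basis is enough because both sides are
  -- k-linear.
  let b := Module.finBasis k (∀ i, M i)
  obtain ⟨a, ha⟩ := jacobson_density f (Finset.univ.image b)
  have hlin : (LinearMap.single k M c ∘ₗ T ∘ₗ LinearMap.proj c) =
      (Algebra.lsmul k k (∀ i, M i) a : (∀ i, M i) →ₗ[k] (∀ i, M i)) :=
    b.ext fun j => ha (b j) (Finset.mem_image_of_mem _ (Finset.mem_univ j))
  have hsm : ∀ m : ∀ i, M i, Pi.single c (T (m c)) = a • m := fun m => LinearMap.congr_fun hlin m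
  refine ⟨a, fun v => ?_, fun d hd v => ?_⟩
  · simpa using (congrFun (hsm (Pi.single c v)) c).symm
  · simpa [hd, Pi.single_eq_of_ne (Ne.symm hd)] using (congrFun (hsm (Pi.single d v)) d).symm

/-! ### Simple representations and coefficients of a class -/

namespace LieFDRep

variable {k : Type u} {g : Type v} [Field k] [LieRing g] [LieAlgebra k g]

/-- Makes simple module theory and density available: submodules over the free algebra are exactly
subrepresentations. -/
noncomputable instance (V : LieFDRep k g) : Module (MonoidAlgebra k (FreeMonoid g)) V.carrier :=
  Module.compHom V.carrier (act V).toRingHom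

theorem smul_eq_act (V : LieFDRep k g) (a : MonoidAlgebra k (FreeMonoid g)) (v : V.carrier) :
    a • v = act V a v := rfl

instance (V : LieFDRep k g) : IsScalarTower k (MonoidAlgebra k (FreeMonoid g)) V.carrier where
  smul_assoc c a v := by simp [smul_eq_act]

theorem of_smul (V : LieFDRep k g) (x : g) (v : V.carrier) :
    MonoidAlgebra.of k _ (FreeMonoid.of x) • v = ⁅x, v⁆ := by
  rw [smul_eq_act, act_of, wordAct_of]

/-- Irreducibility of a representation. -/
abbrev IsSimple (V : LieFDRep k g) : Prop :=
  IsSimpleModule (MonoidAlgebra k (FreeMonoid g)) V.carrier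

theorem Iso.of_algebraLinearEquiv {V W : LieFDRep k g}
    (e : V.carrier ≃ₗ[MonoidAlgebra k (FreeMonoid g)] W.carrier) : Iso V W :=
  Iso.of_linearEquiv (e.restrictScalars k) fun x v => by
    simp [← of_smul]

theorem Iso.isSimple {V W : LieFDRep k g} (h : Iso V W) [hW : IsSimple W] : IsSimple V := by
  obtain ⟨e⟩ := h
  let e' : V.carrier ≃ₗ[MonoidAlgebra k (FreeMonoid g)] W.carrier :=
    { e with map_smul' := fun a v => act_map e.toLieModuleHom a v }
  exact IsSimpleModule.congr e'

/-- A submodule over the free algebra is a Lie submodule. -/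
noncomputable def toLieSubmodule {V : LieFDRep k g}
    (N : Submodule (MonoidAlgebra k (FreeMonoid g)) V.carrier) : LieSubmodule k g V.carrier :=
  { N.restrictScalars k with
    lie_mem := fun {x m} hm => by
      rw [← of_smul]
      exact N.smul_mem _ hm }

theorem exists_shortExact_of_not_isSimple {V : LieFDRep k g} [Nontrivial V.carrier]
    (hV : ¬ IsSimple V) : ∃ U W : LieFDRep k g, ShortExact U V W ∧
      Module.finrank k U.carrier < Module.finrank k V.carrier ∧
      Module.finrank k W.carrier < Module.finrank k V.carrier := by
  obtain ⟨N, hbot, htop⟩ : ∃ N : Submodule (MonoidAlgebra k (FreeMonoid g)) V.carrier,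
      N ≠ ⊥ ∧ N ≠ ⊤ := by
    by_contra! h
    exact hV { eq_bot_or_eq_top := fun N => or_iff_not_imp_left.2 (h N) }
  let L := toLieSubmodule N
  have hbot' : N.restrictScalars k ≠ ⊥ := by simpa using hbot
  have htop' : N.restrictScalars k ≠ ⊤ := by simpa using htop
  have : Module.Finite k (V.carrier ⧸ L) :=
    inferInstanceAs (Module.Finite k (V.carrier ⧸ N.restrictScalars k))
  refine ⟨{ carrier := L }, { carrier := V.carrier ⧸ L },
    ⟨L.incl, LieSubmodule.Quotient.mk' L, L.injective_incl, ?_, ?_⟩, ?_, ?_⟩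
  · intro x
    change (Submodule.Quotient.mk x : V.carrier ⧸ N.restrictScalars k) = 0 ↔ _
    rw [Submodule.Quotient.mk_eq_zero]
    exact ⟨fun h => ⟨⟨x, h⟩, rfl⟩, fun ⟨y, hy⟩ => hy ▸ y.2⟩
  · exact LieSubmodule.Quotient.surjective_mk' L
  · exact Submodule.finrank_lt htop'
  · have h1 := (N.restrictScalars k).finrank_quotient_add_finrank
    have h2 : 0 < Module.finrank k (N.restrictScalars k) :=
      Nat.pos_of_ne_zero fun h => hbot' (Submodule.finrank_eq_zero.1 h)
    change Module.finrank k (V.carrier ⧸ N.restrictScalars k) < _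
    omega

/-- A composition series, in the form of induction on dimension. -/
theorem cls_mem_closure_isSimple (V : LieFDRep k g) :
    cls V ∈ AddSubgroup.closure {x : Gr k g | ∃ S : LieFDRep k g, IsSimple S ∧ cls S = x} := by
  generalize hn : Module.finrank k V.carrier = n
  induction n using Nat.strong_induction_on generalizing V with
  | _ n ih =>
    subst hn
    rcases subsingleton_or_nontrivial V.carrier with h | h
    · rw [cls_eq_zero h]
      exact zero_mem _
    · by_cases hV : IsSimple V
      · exact AddSubgroup.subset_closure ⟨V, hV, rfl⟩
      · obtain ⟨U, W, hs, hU, hW⟩ := exists_shortExact_of_not_isSimple hV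
        rw [hs.cls_eq]
        exact add_mem (ih _ hU U rfl) (ih _ hW W rfl)

/-- A representation in a given isomorphism class. -/
noncomputable def rep (c : IsoClass k g) : LieFDRep k g := Quotient.out c

theorem isoClass_rep (c : IsoClass k g) : isoClass (rep c) = c := Quotient.out_eq c

theorem rep_isoClass (V : LieFDRep k g) : Iso (rep (isoClass V)) V :=
  Quotient.exact (isoClass_rep (isoClass V))

/-- Every element of the Grothendieck ring is an integral combination of pairwise nonisomorphic
irreducible representations. -/
theorem Gr.exists_eq_sum_simple (x : Gr k g) : ∃ m : IsoClass k g →₀ ℤ,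
    (∀ c ∈ m.support, IsSimple (rep c)) ∧
      x = Finsupp.linearCombination ℤ (fun c => cls (rep c)) m := by
  classical
  have hx : x ∈ AddSubgroup.closure
      {x : Gr k g | ∃ S : LieFDRep k g, IsSimple S ∧ cls S = x} := by
    induction x using Gr.induction with
    | hcls V => exact cls_mem_closure_isSimple V
    | h0 => exact zero_mem _
    | hneg a ha => exact neg_mem ha
    | hadd a b ha hb => exact add_mem ha hb
  induction hx using AddSubgroup.closure_induction with
  | zero => exact ⟨0, by simp, by simp⟩
  | mem x hx =>
    obtain ⟨S, hS, rfl⟩ := hx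
    refine ⟨Finsupp.single (isoClass S) 1, fun c hc => ?_, ?_⟩
    · obtain rfl := Finset.mem_singleton.1 (Finsupp.support_single_subset hc)
      exact (rep_isoClass S).isSimple
    · rw [Finsupp.linearCombination_single, one_smul, cls_congr (rep_isoClass S)]
  | add x y _ _ hx hy =>
    obtain ⟨m, hm, rfl⟩ := hx
    obtain ⟨n, hn, rfl⟩ := hy
    refine ⟨m + n, fun c hc => ?_, ?_⟩
    · exact (Finset.mem_union.1 (Finsupp.support_add hc)).elim (hm c) (hn c)
    · rw [map_add]
  | neg x _ hx =>
    obtain ⟨m, hm, rfl⟩ := hx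
    refine ⟨-m, fun c hc => hm c (by simpa using hc), (map_neg _ _).symm⟩

/-- Some element of the free algebra induces a prescribed endomorphism of one irreducible
representation, provided it commutes with the intertwiners, and kills finitely many others. -/
theorem exists_act_eq (s : Finset (IsoClass k g)) (hs : ∀ c ∈ s, IsSimple (rep c))
    {c : IsoClass k g} (hc : c ∈ s) (T : Module.End k (rep c).carrier)
    (hT : ∀ (φ : Module.End (MonoidAlgebra k (FreeMonoid g)) (rep c).carrier) (v : (rep c).carrier),
      T (φ v) = φ (T v)) :
    ∃ a, act (rep c) a = T ∧ ∀ d ∈ s, d ≠ c → act (rep d) a = 0 := by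
  have : ∀ i : s, IsSimpleModule (MonoidAlgebra k (FreeMonoid g)) (rep i.1).carrier :=
    fun i => hs i.1 i.2
  have hne : ∀ d : s, d ≠ ⟨c, hc⟩ → IsEmpty
      ((rep c).carrier ≃ₗ[MonoidAlgebra k (FreeMonoid g)] (rep d.1).carrier) := by
    refine fun d hd => ⟨fun e => hd (Subtype.ext ?_)⟩
    have h : isoClass (rep c) = isoClass (rep d.1) := Quotient.sound (Iso.of_algebraLinearEquiv e)
    rw [isoClass_rep, isoClass_rep] at h
    exact h.symm
  obtain ⟨a, h1, h2⟩ := IsSimpleModule.exists_smul_eq (k := k) (fun i : s => (rep i.1).carrier)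
    ⟨c, hc⟩ hne T hT
  exact ⟨a, LinearMap.ext h1, fun d hd hne => LinearMap.ext
    (h2 ⟨d, hd⟩ fun h => hne (congrArg Subtype.val h))⟩

/-- Isolates one coefficient; it is applied to functionals of elements `a` that kill all the other
constituents. -/
theorem map_sum_simple {M : Type*} [AddCommGroup M] (m : IsoClass k g →₀ ℤ) {c : IsoClass k g}
    (hc : c ∈ m.support) (L : Gr k g →+ M)
    (hL : ∀ d ∈ m.support, d ≠ c → L (cls (rep d)) = 0) :
    L (Finsupp.linearCombination ℤ (fun c => cls (rep c)) m) = m c • L (cls (rep c)) := by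
  rw [Finsupp.linearCombination_apply, Finsupp.sum, map_sum, Finset.sum_eq_single_of_mem c hc fun d hd hne => ?_, map_zsmul]
  rw [map_zsmul, hL d hd hne, smul_zero]

/-- Over an algebraically closed field, a class whose trace function vanishes is divisible by the
characteristic. -/
theorem Gr.exists_eq_ringChar_mul [IsAlgClosed k] {x : Gr k g} (hx : ∀ a, Gr.trace a x = 0) :
    ∃ y : Gr k g, x = (ringChar k : Gr k g) * y := by
  obtain ⟨m, hm, rfl⟩ := Gr.exists_eq_sum_simple x
  have key : ∀ c ∈ m.support, (ringChar k : ℤ) ∣ m c := by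
    intro c hc
    have := hm c hc
    have : Nontrivial (rep c).carrier :=
      IsSimpleModule.nontrivial (MonoidAlgebra k (FreeMonoid g)) (rep c).carrier
    obtain ⟨v, hv⟩ := exists_ne (0 : (rep c).carrier)
    obtain ⟨f, hf⟩ := Module.Projective.exists_dual_eq_one k hv
    -- A rank-one operator of trace f(v) = 1. It commutes with the intertwiners because these are
    -- scalars over an algebraically closed field.
    obtain ⟨a, ha, ha'⟩ := exists_act_eq m.support hm hc (f.smulRight v) <| by
      intro φ w
      obtain ⟨t, rfl⟩ := (IsSimpleModule.algebraMap_end_bijective_of_isAlgClosed k).2 φ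
      simp [Module.algebraMap_end_apply, smul_comm t]
    have h := hx a
    rw [map_sum_simple m hc _ fun d hd hne => by simp [ha' d hd hne], Gr.trace_cls, ha,
      LinearMap.trace_smulRight, hf, zsmul_one] at h
    exact (CharP.intCast_eq_zero_iff k (ringChar k) _).1 h
  choose! n hn using key
  refine ⟨∑ c ∈ m.support, n c • cls (rep c), ?_⟩
  rw [Finsupp.linearCombination_apply, Finset.mul_sum]
  refine Finset.sum_congr rfl fun c hc => ?_
  change m c • cls (rep c) = _
  rw [hn c hc, zsmul_eq_mul, zsmul_eq_mul, Int.cast_mul, Int.cast_natCast, mul_assoc]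

end LieFDRep

/-! ### Extension of scalars -/

/-- Both sides are K-linear in each variable, and the tensors 1 ⊗ x and 1 ⊗ m span over K. -/
theorem LieAlgebra.ExtendScalars.map_lie_of_one_tmul {k g K M N : Type*} [Field k] [LieRing g]
    [LieAlgebra k g] [Field K] [Algebra k K] [AddCommGroup M] [Module k M] [LieRingModule g M]
    [LieModule k g M] [AddCommGroup N] [Module K N] [LieRingModule (K ⊗[k] g) N]
    [LieModule K (K ⊗[k] g) N] (φ : K ⊗[k] M →ₗ[K] N) (h : ∀ (x : g) (m : M),
      φ ((1 : K) ⊗ₜ[k] ⁅x, m⁆) = ⁅(1 : K) ⊗ₜ[k] x, φ ((1 : K) ⊗ₜ[k] m)⁆)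
    (x : K ⊗[k] g) (t : K ⊗[k] M) : φ ⁅x, t⁆ = ⁅x, φ t⁆ := by
  have hg : ∀ (a : K) (x : g), a ⊗ₜ[k] x = a • ((1 : K) ⊗ₜ[k] x) := fun a x => by
    rw [TensorProduct.smul_tmul', smul_eq_mul, mul_one]
  have hM : ∀ (a : K) (m : M), a ⊗ₜ[k] m = a • ((1 : K) ⊗ₜ[k] m) := fun a m => by
    rw [TensorProduct.smul_tmul', smul_eq_mul, mul_one]
  have hadd : ∀ (x y : K ⊗[k] g) (t : K ⊗[k] M), ⁅x + y, t⁆ = ⁅x, t⁆ + ⁅y, t⁆ :=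
    fun x y t => add_lie (L := K ⊗[k] g) (M := K ⊗[k] M) x y t
  have hadd' : ∀ (x : K ⊗[k] g) (s t : K ⊗[k] M), ⁅x, s + t⁆ = ⁅x, s⁆ + ⁅x, t⁆ :=
    fun x s t => lie_add (L := K ⊗[k] g) (M := K ⊗[k] M) x s t
  have hzero : ∀ t : K ⊗[k] M, ⁅(0 : K ⊗[k] g), t⁆ = 0 :=
    fun t => zero_lie (L := K ⊗[k] g) (M := K ⊗[k] M) t
  have hzero' : ∀ x : K ⊗[k] g, ⁅x, (0 : K ⊗[k] M)⁆ = 0 :=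
    fun x => lie_zero (L := K ⊗[k] g) (M := K ⊗[k] M) x
  induction x using TensorProduct.induction_on with
  | zero => rw [hzero, zero_lie, map_zero]
  | add x y hx hy => rw [hadd, add_lie, map_add, hx, hy]
  | tmul a x =>
    induction t using TensorProduct.induction_on with
    | zero => rw [hzero', map_zero, lie_zero]
    | add m n hm hn => rw [hadd', map_add, map_add, lie_add, hm, hn]
    | tmul b m =>
      rw [LieAlgebra.ExtendScalars.bracket_tmul, hM, map_smul, h, hg a, hM b, smul_lie, map_smul,
        lie_smul, smul_smul]

namespace LieFDRep

section BaseChange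

variable {k : Type u} {g : Type v} [Field k] [LieRing g] [LieAlgebra k g]
  (K : Type u) [Field K] [Algebra k K]

/-- Extension of scalars of a representation. -/
def baseChange (V : LieFDRep k g) : LieFDRep K (K ⊗[k] g) where
  carrier := K ⊗[k] V.carrier

/-- Extension of scalars of an intertwiner. -/
noncomputable def baseChangeHom {V W : LieFDRep k g} (φ : V.carrier →ₗ⁅k, g⁆ W.carrier) :
    (baseChange K V).carrier →ₗ⁅K, K ⊗[k] g⁆ (baseChange K W).carrier :=
  { (φ : V.carrier →ₗ[k] W.carrier).baseChange K with
    map_lie' := fun {x m} => by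
      refine LieAlgebra.ExtendScalars.map_lie_of_one_tmul
        ((φ : V.carrier →ₗ[k] W.carrier).baseChange K) (fun x m => ?_) x m
      simp }

theorem ShortExact.baseChange {U V W : LieFDRep k g} (h : ShortExact U V W) :
    ShortExact (baseChange K U) (baseChange K V) (baseChange K W) := by
  obtain ⟨i, p, hi, hip, hp⟩ := h
  refine ⟨baseChangeHom K i, baseChangeHom K p, ?_, ?_, ?_⟩
  · exact Module.Flat.lTensor_preserves_injective_linearMap (M := K)
      (i : U.carrier →ₗ[k] V.carrier) hi
  · exact _root_.lTensor_exact K (f := (i : U.carrier →ₗ[k] V.carrier))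
      (g := (p : V.carrier →ₗ[k] W.carrier)) hip hp
  · exact LinearMap.lTensor_surjective K (g := (p : V.carrier →ₗ[k] W.carrier)) hp

theorem baseChange_tensor (V W : LieFDRep k g) :
    Iso (baseChange K (tensor V W)) (tensor (baseChange K V) (baseChange K W)) := by
  refine Iso.of_linearEquiv (V := baseChange K (tensor V W))
    (W := tensor (baseChange K V) (baseChange K W))
    (TensorProduct.AlgebraTensorModule.distribBaseChange k K V.carrier W.carrier) ?_
  refine LieAlgebra.ExtendScalars.map_lie_of_one_tmul (k := k) (g := g) (K := K)
    (N := (K ⊗[k] V.carrier) ⊗[K] (K ⊗[k] W.carrier))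
    (TensorProduct.AlgebraTensorModule.distribBaseChange k K V.carrier W.carrier).toLinearMap ?_
  intro x m
  change V.carrier ⊗[k] W.carrier at m
  change TensorProduct.AlgebraTensorModule.distribBaseChange k K V.carrier W.carrier
    ((1 : K) ⊗ₜ[k] ⁅x, m⁆) = ⁅(1 : K) ⊗ₜ[k] x,
      TensorProduct.AlgebraTensorModule.distribBaseChange k K V.carrier W.carrier
        ((1 : K) ⊗ₜ[k] m)⁆
  induction m using TensorProduct.induction_on with
  | zero =>
    simp only [lie_zero, TensorProduct.tmul_zero, map_zero]
    exact (lie_zero (L := K ⊗[k] g) (M := (K ⊗[k] V.carrier) ⊗[K] (K ⊗[k] W.carrier)) _).symm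
  | add m n hm hn =>
    simp only [TensorProduct.tmul_add, lie_add, map_add, hm, hn]
    exact (lie_add (L := K ⊗[k] g) (M := (K ⊗[k] V.carrier) ⊗[K] (K ⊗[k] W.carrier)) _ _ _).symm
  | tmul v w =>
    rw [TensorProduct.LieModule.lie_tmul_right, TensorProduct.tmul_add, map_add,
      TensorProduct.AlgebraTensorModule.distribBaseChange_tmul,
      TensorProduct.AlgebraTensorModule.distribBaseChange_tmul,
      TensorProduct.AlgebraTensorModule.distribBaseChange_tmul,
      TensorProduct.LieModule.lie_tmul_right]
    erw [LieAlgebra.ExtendScalars.bracket_tmul, LieAlgebra.ExtendScalars.bracket_tmul]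
    rw [one_mul]

theorem baseChange_triv : Iso (baseChange K (triv k g)) (triv K (K ⊗[k] g)) := by
  refine Iso.of_linearEquiv (V := baseChange K (triv k g)) (W := triv K (K ⊗[k] g))
    ((TensorProduct.AlgebraTensorModule.congr (LinearEquiv.refl K K)
      (TrivialLieModule.equiv k g k)).trans ((TensorProduct.AlgebraTensorModule.rid k K K).trans
        (TrivialLieModule.equiv K (K ⊗[k] g) K).symm)) ?_
  refine LieAlgebra.ExtendScalars.map_lie_of_one_tmul (k := k) (g := g) (K := K)
    (N := TrivialLieModule K (K ⊗[k] g) K)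
    (M := TrivialLieModule k g k)
    (((TensorProduct.AlgebraTensorModule.congr (LinearEquiv.refl K K)
      (TrivialLieModule.equiv k g k)).trans ((TensorProduct.AlgebraTensorModule.rid k K K).trans
        (TrivialLieModule.equiv K (K ⊗[k] g) K).symm)).toLinearMap) ?_
  intro x m
  rw [trivial_lie_zero g (TrivialLieModule k g k) x m, TensorProduct.tmul_zero, map_zero,
    trivial_lie_zero (K ⊗[k] g) (TrivialLieModule K (K ⊗[k] g) K)]

/-- Extension of scalars on Grothendieck rings. -/
noncomputable def Gr.baseChange : Gr k g →+* Gr K (K ⊗[k] g) :=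
  { Gr.lift (fun V => cls (LieFDRep.baseChange K V)) fun _ _ _ h => (h.baseChange K).cls_eq with
    map_one' := by
      change Gr.lift _ _ (cls (triv k g)) = 1
      rw [Gr.lift_cls, cls_congr (baseChange_triv K), one_eq_cls]
    map_mul' := fun x y => by
      change Gr.lift _ _ (x * y) = Gr.lift _ _ x * Gr.lift _ _ y
      induction x using Gr.induction with
      | h0 => simp
      | hneg a ha => simp only [neg_mul, map_neg, ha]
      | hadd a b ha hb => simp only [add_mul, map_add, ha, hb]
      | hcls V =>
        induction y using Gr.induction with
        | h0 => simp
        | hneg a ha => simp only [mul_neg, map_neg, ha]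
        | hadd a b ha hb => simp only [mul_add, map_add, ha, hb]
        | hcls W =>
          rw [cls_mul, Gr.lift_cls, Gr.lift_cls, Gr.lift_cls, cls_mul,
            cls_congr (baseChange_tensor K V W)] }

@[simp]
theorem Gr.baseChange_cls (V : LieFDRep k g) :
    Gr.baseChange K (cls V) = cls (LieFDRep.baseChange K V) :=
  Gr.lift_cls _ (fun _ _ _ h => (h.baseChange K).cls_eq) _

/-- Pure tensors in an extension of scalars. -/
def baseChangeTMul (V : LieFDRep k g) (a : K) (v : V.carrier) : (baseChange K V).carrier :=
  a ⊗ₜ[k] v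

theorem wordAct_baseChange_apply (V : LieFDRep k g) (l : List g) (a : K) (v : V.carrier) :
    wordAct (baseChange K V) (FreeMonoid.ofList (l.map fun x => (1 : K) ⊗ₜ[k] x))
      (baseChangeTMul K V a v) = baseChangeTMul K V a (wordAct V (FreeMonoid.ofList l) v) := by
  induction l with
  | nil => rfl
  | cons x l ih =>
    rw [List.map_cons, FreeMonoid.ofList_cons, FreeMonoid.ofList_cons, map_mul, map_mul,
      Module.End.mul_apply, Module.End.mul_apply, ih, wordAct_of, wordAct_of]
    exact (LieAlgebra.ExtendScalars.bracket_tmul ..).trans (by rw [one_mul]; rfl)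

/-- Replace each letter x by 1 ⊗ x and each coefficient by its image in K. A single `b` must serve
all V, so that it defines one functional on the Grothendieck group. -/
theorem exists_act_baseChange (a : MonoidAlgebra k (FreeMonoid g)) :
    ∃ b : MonoidAlgebra K (FreeMonoid (K ⊗[k] g)), ∀ V : LieFDRep k g,
      (act (baseChange K V) b : K ⊗[k] V.carrier →ₗ[K] K ⊗[k] V.carrier) =
        (act V a).baseChange K := by
  suffices h : ∃ b : MonoidAlgebra K (FreeMonoid (K ⊗[k] g)), ∀ (V : LieFDRep k g) (c : K)
      (v : V.carrier), act (baseChange K V) b (baseChangeTMul K V c v) =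
        baseChangeTMul K V c (act V a v) by
    obtain ⟨b, hb⟩ := h
    refine ⟨b, fun V => ?_⟩
    refine LinearMap.ext fun t => ?_
    induction t using TensorProduct.induction_on with
    | zero => exact (map_zero (act (baseChange K V) b)).trans (map_zero _).symm
    | add s t hs ht =>
      exact (map_add (act (baseChange K V) b) s t).trans
        ((congrArg₂ (· + ·) hs ht).trans (map_add _ s t).symm)
    | tmul c v => exact hb V c v
  induction a using MonoidAlgebra.induction_on with
  | of w =>
    refine ⟨word K (w.toList.map fun x => (1 : K) ⊗ₜ[k] x), fun V c v => ?_⟩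
    rw [act_of, act_of]
    exact wordAct_baseChange_apply K V w.toList c v
  | add x y hx hy =>
    obtain ⟨b, hb⟩ := hx
    obtain ⟨d, hd⟩ := hy
    refine ⟨b + d, fun V c v => ?_⟩
    rw [map_add, map_add, LinearMap.add_apply, LinearMap.add_apply, hb, hd]
    exact (TensorProduct.tmul_add c (act V x v) (act V y v)).symm
  | smul r x hx =>
    obtain ⟨b, hb⟩ := hx
    refine ⟨algebraMap k K r • b, fun V c v => ?_⟩
    rw [map_smul, map_smul, LinearMap.smul_apply, LinearMap.smul_apply, hb]
    exact (algebraMap_smul K r (c ⊗ₜ[k] (act V x v) : K ⊗[k] V.carrier)).trans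
      (TensorProduct.tmul_smul r c (act V x v)).symm

/-- Characteristic polynomials commute with base change, and a field embedding preserves root
multiplicities. -/
theorem Gr.exists_eigenMult_baseChange (a : MonoidAlgebra k (FreeMonoid g)) :
    ∃ b : MonoidAlgebra K (FreeMonoid (K ⊗[k] g)), ∀ x : Gr k g,
      Gr.eigenMult b (Gr.baseChange K x) = Gr.eigenMult a x := by
  obtain ⟨b, hb⟩ := exists_act_baseChange K a
  refine ⟨b, fun x => ?_⟩
  induction x using Gr.induction with
  | h0 => simp
  | hneg a ha => simp only [map_neg, ha]
  | hadd a b ha hb => simp only [map_add, ha, hb]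
  | hcls V =>
    have h : (act (LieFDRep.baseChange K V) b).charpoly =
        (act V a).charpoly.map (algebraMap k K) :=
      (congrArg LinearMap.charpoly (hb V)).trans (LinearMap.charpoly_baseChange _ K)
    rw [Gr.baseChange_cls, Gr.eigenMult_cls, Gr.eigenMult_cls, h,
      Polynomial.eq_rootMultiplicity_map (algebraMap k K).injective, map_one]

theorem Gr.trace_one_baseChange (x : Gr k g) :
    Gr.trace 1 (Gr.baseChange K x) = algebraMap k K (Gr.trace 1 x) := by
  induction x using Gr.induction with
  | h0 => simp
  | hneg a ha => simp only [map_neg, ha]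
  | hadd a b ha hb => simp only [map_add, ha, hb]
  | hcls V =>
    have : Module.finrank K (LieFDRep.baseChange K V).carrier = Module.finrank k V.carrier :=
      Module.finrank_baseChange
    rw [Gr.baseChange_cls, Gr.trace_cls, Gr.trace_cls, map_one (act _), map_one (act V), LinearMap.trace_one,
      LinearMap.trace_one, this, map_natCast]

end BaseChange

/-! ### Idempotents of the Grothendieck ring -/

/-- Allows q = 0, so that characteristic zero needs no separate treatment; n ≠ 0 matches eⁿ = e. -/
theorem _root_.Int.eq_zero_of_forall_pow_dvd {q : ℕ} (hq : q ≠ 1) {z : ℤ}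
    (h : ∀ n : ℕ, n ≠ 0 → (q : ℤ) ^ n ∣ z) : z = 0 := by
  by_contra hz
  have hfin : FiniteMultiplicity (q : ℤ) z := Int.finiteMultiplicity_iff.2 ⟨by simpa using hq, hz⟩
  obtain ⟨n, hn⟩ := hfin
  exact hn (h (n + 1) n.succ_ne_zero)

variable {k : Type u} {g : Type v} [Field k] [LieRing g] [LieAlgebra k g]

/-- An idempotent of rank zero is annihilated by every eigenvalue multiplicity: over an
algebraically closed field it is divisible by all powers of the characteristic. -/
theorem Gr.eigenMult_eq_zero_of_isIdempotentElem {e : Gr k g} (he : IsIdempotentElem e)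
    (h1 : Gr.trace 1 e = 0) (a : MonoidAlgebra k (FreeMonoid g)) : Gr.eigenMult a e = 0 := by
  let K := AlgebraicClosure k
  have he' : IsIdempotentElem (Gr.baseChange K e) := he.map (Gr.baseChange K)
  have h1' : Gr.trace 1 (Gr.baseChange K e) = 0 := by
    rw [Gr.trace_one_baseChange, h1, map_zero]
  obtain ⟨y, hy⟩ :=
    Gr.exists_eq_ringChar_mul (Gr.trace_eq_zero_of_isIdempotentElem he' h1')
  obtain ⟨b, hb⟩ := Gr.exists_eigenMult_baseChange K a
  rw [← hb]
  refine Int.eq_zero_of_forall_pow_dvd (CharP.ringChar_ne_one (R := K)) fun n hn => ?_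
  refine ⟨Gr.eigenMult b (y ^ n), ?_⟩
  -- Writes e = eⁿ = pⁿ yⁿ and takes the integer pⁿ out of the additive map.
  rw [← he'.pow_eq hn, hy, mul_pow, ← Nat.cast_pow, ← nsmul_eq_mul, map_nsmul, nsmul_eq_mul,
    Nat.cast_pow]

theorem Gr.eq_zero_of_isIdempotentElem {e : Gr k g} (he : IsIdempotentElem e)
    (h1 : Gr.trace 1 e = 0) : e = 0 := by
  obtain ⟨m, hm, hem⟩ := Gr.exists_eq_sum_simple e
  suffices h : m = 0 by rw [hem, h, map_zero]
  rw [← Finsupp.support_eq_empty, Finset.eq_empty_iff_forall_notMem]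
  intro c hc
  -- The identity commutes with all intertwiners, so k need not be algebraically closed. The
  -- eigenvalue 1 then has multiplicity dim on the chosen constituent and 0 where `a` acts as zero.
  obtain ⟨a, ha, ha'⟩ := exists_act_eq m.support hm hc 1 fun _ _ => rfl
  have h := Gr.eigenMult_eq_zero_of_isIdempotentElem he h1 a
  rw [hem, map_sum_simple m hc _ fun d hd hne => by
      rw [Gr.eigenMult_cls, ha' d hd hne, LinearMap.charpoly_zero]; simp,
    Gr.eigenMult_cls, ha, LinearMap.charpoly_one] at h
  have := hm c hc
  have : Nontrivial (rep c).carrier :=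
    IsSimpleModule.nontrivial (MonoidAlgebra k (FreeMonoid g)) (rep c).carrier
  have hpos : Module.finrank k (rep c).carrier ≠ 0 := Module.finrank_pos.ne'
  rw [← Polynomial.C_1, Polynomial.rootMultiplicity_X_sub_C_pow] at h
  simp only [smul_eq_mul, mul_eq_zero, Nat.cast_eq_zero, hpos, or_false] at h
  exact (Finsupp.mem_support_iff.1 hc) h

theorem Gr.isIdempotentElem_iff {e : Gr k g} : IsIdempotentElem e ↔ e = 0 ∨ e = 1 := by
  refine ⟨fun he => ?_, ?_⟩
  · have h : Gr.trace 1 e * Gr.trace 1 e = Gr.trace 1 e := by rw [← Gr.trace_one_mul, he.eq]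
    rcases IsIdempotentElem.iff_eq_zero_or_one.1 h with h | h
    · exact Or.inl (Gr.eq_zero_of_isIdempotentElem he h)
    · refine Or.inr (sub_eq_zero.1 (Gr.eq_zero_of_isIdempotentElem he.one_sub ?_)).symm
      rw [map_sub, Gr.trace_one_one, h, sub_self]
  · rintro (rfl | rfl)
    · exact IsIdempotentElem.zero
    · exact IsIdempotentElem.one

instance : Nontrivial (Gr k g) :=
  ⟨⟨1, 0, fun h => one_ne_zero (α := k) (by
    rw [← Gr.trace_one_one (k := k) (g := g), h, map_zero])⟩⟩

end LieFDRep

/-- The spectrum of the Grothendieck ring of the category of finite-dimensional representations of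
any Lie algebra over any field is connected (and non-empty). -/
theorem theorem2p7 (k : Type u) (g : Type v) [Field k] [LieRing g] [LieAlgebra k g] :
    ConnectedSpace (PrimeSpectrum (LieFDRep.Gr k g)) := by
  have : PreconnectedSpace (PrimeSpectrum (LieFDRep.Gr k g)) := by
    rw [preconnectedSpace_iff_clopen]
    intro s hs
    obtain ⟨e, he, rfl⟩ := PrimeSpectrum.exists_idempotent_basicOpen_eq_of_isClopen hs
    rcases LieFDRep.Gr.isIdempotentElem_iff.1 he with rfl | rfl
    · exact Or.inl (by simp)
    · exact Or.inr (by simp)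
  exact { toNonempty := inferInstance }
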